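/- Let $\mathbb{N}=\{1,2,\dots\}$. Let $s(n,k)$, $n\ge k\ge 0$, be the (signed) Stirling numbers of the first kind, generated by $$\frac{[\ln(1+x)]^k}{k!}=\sum_{n=k}^\infty s(n,k)\frac{x^n}{n!},\qquad |x|<1 .$$ For $k\in\mathbb{N}$ and $m\ge 2$ put $$Q(k,m)=\sum_{\ell=0}^{m}\binom{k+\ell-1}{k-1}\,s(k+m-1,k+\ell-1)\left(\frac{k+m-2}{2}\right)^{\ell},$$ and let $\langle\beta\rangle_j=\prod_{i=0}^{j-1}(\beta-i)$ denote the falling factorial. Then for all $k,n\in\mathbb{N}$, $$\sum_{j=1}^{n}(-1)^j\,\frac{\langle k\rangle_j}{j!}\sum_{\ell=1}^{j}(-1)^\ell\,(2\ell)!\binom{j}{\ell}\frac{Q(2\ell,2n)}{(2\ell+2n)!}=(2k)!\,\frac{Q(2k,2n)}{(2k+2n)!}.$$ -/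

import Mathlib

/-- The (signed) Stirling number of the first kind `s(n, k)`: Mathlib's unsigned number
`Nat.stirlingFirst n k` with the sign `(-1)^(n-k) = (-1)^(n+k)`; it vanishes for `n < k`. -/
def signedStirlingFirst (n k : ℕ) : ℤ :=
  (-1) ^ (n + k) * (Nat.stirlingFirst n k : ℤ)

/-- The numbers `s(n, k)` are the ones generated by
`[ln(1+x)]^k / k! = ∑_{n ≥ k} s(n, k) x^n / n!` (`PowerSeries.log ℚ` is the series of `ln(1+x)`);
the terms with `n < k` are zero. -/
theorem signedStirlingFirst_generating (k : ℕ) :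
    PowerSeries.C ((1 : ℚ) / (k.factorial : ℚ)) * PowerSeries.log ℚ ^ k =
      PowerSeries.mk fun n => (signedStirlingFirst n k : ℚ) / (n.factorial : ℚ) := by
  have hlog : (1 + PowerSeries.X) * PowerSeries.derivative ℚ (PowerSeries.log ℚ) = 1 := by
    rw [PowerSeries.deriv_log]
    ext n
    cases n with
    | zero => simp
    | succ n =>
      rw [add_mul, one_mul, map_add, PowerSeries.coeff_succ_X_mul]
      simp [PowerSeries.coeff_one, pow_succ]
  have hunit : (1 + PowerSeries.X : PowerSeries ℚ) ≠ 0 := by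
    intro h
    have := congrArg PowerSeries.constantCoeff h
    simp at this
  induction k with
  | zero =>
    ext n
    cases n <;> simp [signedStirlingFirst, PowerSeries.coeff_one]
  | succ k ih =>
    refine PowerSeries.derivative.ext (mul_left_cancel₀ hunit ?_) ?_
    · trans PowerSeries.C ((1 : ℚ) / (k.factorial : ℚ)) * PowerSeries.log ℚ ^ k
      · have hc : (PowerSeries.C ((1 : ℚ) / ((k + 1).factorial : ℚ)) : PowerSeries ℚ) * (k + 1) =
            PowerSeries.C ((1 : ℚ) / (k.factorial : ℚ)) := by
          have h1 : ((k : PowerSeries ℚ) + 1) = PowerSeries.C ((k : ℚ) + 1) := by simp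
          rw [h1, ← map_mul, Nat.factorial_succ]
          congr 1
          push_cast
          field_simp
        rw [Derivation.leibniz, PowerSeries.derivative_C, PowerSeries.derivative_pow, ← hc]
        simp only [smul_eq_mul, mul_zero, add_zero, Nat.add_sub_cancel]
        push_cast
        linear_combination (PowerSeries.C ((1 : ℚ) / ((k + 1).factorial : ℚ)) * (k + 1) *
          PowerSeries.log ℚ ^ k) * hlog
      · rw [ih]
        ext n
        cases n with
        | zero =>
          rw [add_mul, one_mul, map_add, PowerSeries.coeff_derivative]
          have hs : (-1 : ℚ) ^ (1 + (k + 1)) = (-1) ^ k := by ring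
          simp [signedStirlingFirst, Nat.stirlingFirst_succ_succ, hs]
        | succ n =>
          rw [add_mul, one_mul, map_add, PowerSeries.coeff_succ_X_mul,
            PowerSeries.coeff_derivative, PowerSeries.coeff_derivative]
          simp only [PowerSeries.coeff_mk, signedStirlingFirst,
            Nat.stirlingFirst_succ_succ (n + 1) k, Nat.factorial_succ]
          push_cast
          have : (n.factorial : ℚ) ≠ 0 := by positivity
          field_simp
          ring
    · simp [signedStirlingFirst]

/-- `Q(k, m) = ∑_{ℓ=0}^{m} C(k+ℓ-1, k-1) s(k+m-1, k+ℓ-1) ((k+m-2)/2)^ℓ`, for `k ≥ 1`, `m ≥ 2`.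
In this range none of the natural number subtractions truncates. -/
def Q (k m : ℕ) : ℚ :=
  ∑ l ∈ Finset.range (m + 1),
    ((k + l - 1).choose (k - 1) : ℚ) * (signedStirlingFirst (k + m - 1) (k + l - 1) : ℚ) *
      (((k : ℚ) + (m : ℚ) - 2) / 2) ^ l

/-! With `N = k + n`, shifting the falling factorial of degree `2N - 1` to its centre of symmetry
shows that `Q(2k, 2n)` is the coefficient of `x^(2k)` in the central factorial
`∏_{i < N} (x² - i²)`.
These coefficients satisfy `∑_N [x^(2k)] ∏_{i < N} (x² - i²) · y^N / (2N)! = h^(2k) / (2k)!`, where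
`y = (2 sinh (h / 2))²`: in the coordinate `y` the equation `d²/dh² h^(2k) = 2k(2k - 1) h^(2k - 2)`
is their recurrence in `N` and `k`. Hence `a k = (2k)! Q(2k, 2n) / (2k + 2n)!` is the coefficient of
`y^n` in `f^k`, where `f = h² / y` has constant coefficient `1`. As `f - 1` is divisible by `y`, the
forward differences of `a` at `0`, which are the coefficients of `y^n` in `(f - 1)^j`, vanish for
`j > n`, and the identity is Newton's interpolation of `a` at `0, 1, ..., n`.
-/

lemma sum_range_succ_eq_sum_Icc_one {G : Type*} [AddCommMonoid G] {f : ℕ → G} (hf : f 0 = 0)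
    (n : ℕ) : ∑ j ∈ Finset.range (n + 1), f j = ∑ j ∈ Finset.Icc 1 n, f j := by
  rw [Nat.range_succ_eq_Icc_zero, ← Finset.add_sum_Ioc_eq_sum_Icc n.zero_le, hf, zero_add]
  rfl

lemma fwdDiff_iter_zero_eq_sum_Icc {R : Type*} [CommRing R] {a : ℕ → R} (ha : a 0 = 0) (j : ℕ) :
    (fwdDiff 1)^[j] a 0 = (-1) ^ j * ∑ l ∈ Finset.Icc 1 j, (-1) ^ l * (j.choose l : R) * a l := by
  rw [← sum_range_succ_eq_sum_Icc_one (by simp [ha]), fwdDiff_iter_eq_sum_shift, Finset.mul_sum]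
  refine Finset.sum_congr rfl fun l hl => ?_
  have hsign : (-1 : R) ^ (j - l) = (-1) ^ j * (-1) ^ l := by
    rw [← pow_sub_mul_pow (-1 : R) (Finset.mem_range_succ_iff.1 hl), mul_assoc, ← mul_pow]
    simp
  simp only [zero_add, smul_eq_mul, mul_one, zsmul_eq_mul, Int.cast_mul, Int.cast_pow, Int.cast_neg,
    Int.cast_one, Int.cast_natCast, hsign]
  ring

lemma eq_sum_choose_smul_fwdDiff_iter {G : Type*} [AddCommGroup G] {a : ℕ → G} {n : ℕ}
    (ha : ∀ j, n < j → (fwdDiff 1)^[j] a 0 = 0) (k : ℕ) :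
    a k = ∑ j ∈ Finset.range (n + 1), k.choose j • (fwdDiff 1)^[j] a 0 := by
  have newton : a k = ∑ j ∈ Finset.range (k + 1), k.choose j • (fwdDiff 1)^[j] a 0 := by
    simpa using shift_eq_sum_fwdDiff_iter 1 a k 0
  rw [newton]
  refine Finset.sum_congr_of_eq_on_inter (fun j _ hj => ?_) (fun j _ hj => ?_) fun _ _ _ => rfl
  · rw [ha j (by simpa using hj), smul_zero]
  · rw [Nat.choose_eq_zero_of_lt (by simpa using hj), zero_smul]

lemma fwdDiff_iter_coeff_pow {R : Type*} [CommRing R] (f : PowerSeries R) (n j k : ℕ) :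
    (fwdDiff 1)^[j] (fun l => PowerSeries.coeff n (f ^ l)) k =
      PowerSeries.coeff n ((f - 1) ^ j * f ^ k) := by
  induction j generalizing k with
  | zero => simp
  | succ j ih =>
    rw [Function.iterate_succ_apply', fwdDiff, ih, ih, ← map_sub]
    congr 1
    ring

theorem coeff_pow_eq_sum_Icc {R : Type*} [CommRing R] {f : PowerSeries R}
    (hf : PowerSeries.constantCoeff f = 1) {n : ℕ} (hn : n ≠ 0) (k : ℕ) :
    PowerSeries.coeff n (f ^ k) =
      ∑ j ∈ Finset.Icc 1 n, (-1) ^ j * (k.choose j : R) *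
        ∑ l ∈ Finset.Icc 1 j, (-1) ^ l * (j.choose l : R) * PowerSeries.coeff n (f ^ l) := by
  set a : ℕ → R := fun l => PowerSeries.coeff n (f ^ l)
  have a_zero : a 0 = 0 := by simp [a, PowerSeries.coeff_one, hn]
  have diff_vanish (j : ℕ) (hj : n < j) : (fwdDiff 1)^[j] a 0 = 0 := by
    have hX : PowerSeries.X ∣ f - 1 := PowerSeries.X_dvd_iff.2 (by simp [hf])
    rw [fwdDiff_iter_coeff_pow, pow_zero, mul_one]
    exact PowerSeries.X_pow_dvd_iff.1 (pow_dvd_pow_of_dvd hX j) n hj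
  change a k = _
  rw [eq_sum_choose_smul_fwdDiff_iter diff_vanish, sum_range_succ_eq_sum_Icc_one (by simp [a_zero])]
  refine Finset.sum_congr rfl fun j _ => ?_
  rw [fwdDiff_iter_zero_eq_sum_Icc a_zero, nsmul_eq_mul, mul_left_comm, mul_assoc]

section CentralFactorial

open Polynomial

lemma coeff_descPochhammer (R : Type*) [Ring R] (n k : ℕ) :
    (descPochhammer R n).coeff k = (signedStirlingFirst n k : R) := by
  induction n generalizing k with
  | zero => cases k <;> simp [signedStirlingFirst, coeff_one]
  | succ n ih =>
    rw [descPochhammer_succ_right, mul_sub, coeff_sub, ← C_eq_natCast, coeff_mul_C]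
    cases k with
    | zero =>
      rw [mul_coeff_zero, coeff_X_zero, ih]
      cases n <;> simp [signedStirlingFirst]
    | succ k =>
      rw [coeff_mul_X, ih, ih, ← Int.cast_natCast n, ← Int.cast_mul, ← Int.cast_sub]
      congr 1
      simp only [signedStirlingFirst, Nat.stirlingFirst_succ_succ]
      push_cast
      ring

lemma coeff_taylor_eq_sum {R : Type*} [CommSemiring R] {p : R[X]} {k m : ℕ}
    (hp : p.natDegree ≤ k + m) (r : R) :
    (taylor r p).coeff k =
      ∑ l ∈ Finset.range (m + 1), ((k + l).choose k : R) * p.coeff (k + l) * r ^ l := by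
  have hdeg : (hasseDeriv k p).natDegree < m + 1 :=
    (natDegree_hasseDeriv_le p k).trans_lt (by lia)
  rw [taylor_coeff, eval_eq_sum_range' hdeg]
  exact Finset.sum_congr rfl fun l _ => by rw [hasseDeriv_coeff, add_comm l k]

lemma Q_succ_eq_coeff_taylor (k m : ℕ) :
    Q (k + 1) m = (taylor (((k : ℚ) + m - 1) / 2) (descPochhammer ℚ (k + m))).coeff k := by
  rw [coeff_taylor_eq_sum (descPochhammer_natDegree ℚ (k + m)).le, Q]
  refine Finset.sum_congr rfl fun l _ => ?_
  have hcenter : (((k + 1 : ℕ) : ℚ) + m - 2) / 2 = ((k : ℚ) + m - 1) / 2 := by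
    push_cast
    ring
  rw [coeff_descPochhammer, hcenter, Nat.add_sub_cancel, Nat.add_right_comm k 1 l,
    Nat.add_sub_cancel, Nat.add_right_comm k 1 m, Nat.add_sub_cancel]

/-- The central factorial `x^[2n] = ∏_{i < n} (x² - i²)`, as a polynomial in `x²`; its coefficients
are the central factorial numbers of the first kind with even indices. -/
noncomputable def evenCentralFactorial (R : Type*) [CommRing R] (n : ℕ) : R[X] :=
  ∏ i ∈ Finset.range n, (X - C ((i : R) ^ 2))

lemma evenCentralFactorial_zero (R : Type*) [CommRing R] : evenCentralFactorial R 0 = 1 :=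
  Finset.prod_range_zero _

lemma evenCentralFactorial_succ (R : Type*) [CommRing R] (n : ℕ) :
    evenCentralFactorial R (n + 1) = evenCentralFactorial R n * (X - C ((n : R) ^ 2)) :=
  Finset.prod_range_succ _ _

lemma coeff_zero_evenCentralFactorial_succ (R : Type*) [CommRing R] (n : ℕ) :
    (evenCentralFactorial R (n + 1)).coeff 0 = 0 := by
  rw [evenCentralFactorial, Finset.prod_range_succ', mul_coeff_zero]
  simp

lemma coeff_succ_evenCentralFactorial_succ (R : Type*) [CommRing R] (n k : ℕ) :
    (evenCentralFactorial R (n + 1)).coeff (k + 1) =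
      (evenCentralFactorial R n).coeff k - n ^ 2 * (evenCentralFactorial R n).coeff (k + 1) := by
  rw [evenCentralFactorial_succ, mul_sub, coeff_sub, coeff_mul_X, coeff_mul_C, mul_comm (_ ^ 2)]

lemma X_mul_taylor_descPochhammer (R : Type*) [CommRing R] (n : ℕ) :
    X * taylor (n : R) (descPochhammer R (2 * n + 1)) =
      expand R 2 (evenCentralFactorial R (n + 1)) := by
  induction n with
  | zero => simp [evenCentralFactorial, pow_two]
  | succ n ih =>
    have shift : taylor ((n + 1 : ℕ) : R) ((descPochhammer R (2 * n + 1)).comp (X - 1)) =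
        taylor (n : R) (descPochhammer R (2 * n + 1)) := by
      rw [taylor_apply, comp_assoc, taylor_apply]
      congr 1
      simp only [sub_comp, X_comp, one_comp, Nat.cast_add, Nat.cast_one, map_add, map_one]
      ring
    have outer_factors : descPochhammer R (2 * (n + 1) + 1) =
        X * (descPochhammer R (2 * n + 1)).comp (X - 1) * (X - ((2 * n + 1 + 1 : ℕ) : R[X])) := by
      rw [← descPochhammer_succ_left, ← descPochhammer_succ_right]
      rfl
    rw [evenCentralFactorial_succ, map_mul, ← ih, outer_factors, taylor_mul, taylor_mul, shift]
    simp only [map_sub, taylor_X, ← C_eq_natCast, taylor_C, expand_X, expand_C]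
    simp only [Nat.cast_add, Nat.cast_mul, Nat.cast_one, Nat.cast_ofNat, map_add, map_mul, map_one,
      map_pow, map_ofNat]
    ring

theorem Q_two_mul_eq_coeff_evenCentralFactorial {k : ℕ} (hk : 1 ≤ k) (n : ℕ) :
    Q (2 * k) (2 * n) = (evenCentralFactorial ℚ (k + n)).coeff k := by
  obtain ⟨k, rfl⟩ := Nat.exists_eq_add_of_le' hk
  have hcenter : (((2 * k + 1 : ℕ) : ℚ) + (2 * n : ℕ) - 1) / 2 = (k + n : ℕ) := by
    push_cast
    ring
  rw [show 2 * (k + 1) = 2 * k + 1 + 1 by ring, Q_succ_eq_coeff_taylor, hcenter, ← coeff_X_mul,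
    show 2 * k + 1 + 2 * n = 2 * (k + n) + 1 by ring, X_mul_taylor_descPochhammer,
    show 2 * k + 1 + 1 = (k + 1) * 2 by ring, coeff_expand_mul two_pos, Nat.add_right_comm]

end CentralFactorial

section Arsinh

open PowerSeries

/-- The differential operator `(4y + y²) ∂² + (2 + y) ∂`, which is `d²/dh²` in the coordinate
`y = (2 sinh (h / 2))²`. -/
noncomputable def arsinhOp {R : Type*} [CommSemiring R] (f : R⟦X⟧) : R⟦X⟧ :=
  (4 * X + X ^ 2) * d⁄dX R (d⁄dX R f) + (2 + X) * d⁄dX R f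

lemma coeff_arsinhOp {R : Type*} [CommSemiring R] (f : R⟦X⟧) (n : ℕ) :
    coeff n (arsinhOp f) = (2 * n + 2) * (2 * n + 1) * coeff (n + 1) f + n ^ 2 * coeff n f := by
  rw [arsinhOp, add_mul, add_mul, pow_two, ← map_ofNat (C (R := R)) 4, ← map_ofNat (C (R := R)) 2,
    mul_assoc, mul_assoc X X]
  simp only [map_add, coeff_C_mul]
  rcases n with _ | _ | n
  · simp [coeff_derivative]
  · simp only [zero_add, coeff_succ_X_mul, coeff_zero_X_mul, coeff_derivative]
    push_cast
    ring
  · simp only [coeff_succ_X_mul, coeff_derivative]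
    push_cast
    ring

lemma arsinhOp_pow_add_two {R : Type*} [CommSemiring R] (f : R⟦X⟧) (k : ℕ) :
    arsinhOp (f ^ (k + 2)) = ((k + 2 : ℕ) : R⟦X⟧) * f ^ (k + 1) * arsinhOp f +
      (((k + 2) * (k + 1) : ℕ) : R⟦X⟧) * f ^ k * ((4 * X + X ^ 2) * d⁄dX R f ^ 2) := by
  simp only [arsinhOp, derivative_pow, Derivation.leibniz, Derivation.map_natCast, smul_eq_mul,
    Nat.add_succ_sub_one]
  push_cast
  ring

/-- The power series of `(2 arsinh (√y / 2))² / y`. -/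
noncomputable def arsinhSqDiv (K : Type*) [Field K] : K⟦X⟧ :=
  mk fun n => 2 * (-1) ^ n * (n.factorial : K) ^ 2 / ((2 * (n + 1)).factorial : K)

/-- The power series of `(2 arsinh (√y / 2))²`, which is `h²` in the coordinate `h` of
`arsinhOp`. -/
noncomputable def arsinhSq (K : Type*) [Field K] : K⟦X⟧ :=
  X * arsinhSqDiv K

lemma cast_factorial_two_mul_succ (R : Type*) [CommSemiring R] (n : ℕ) :
    ((2 * (n + 1)).factorial : R) = (2 * n + 2) * (2 * n + 1) * ((2 * n).factorial : R) := by
  rw [show 2 * (n + 1) = 2 * n + 1 + 1 by ring, Nat.factorial_succ, Nat.factorial_succ]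
  push_cast
  ring

variable (K : Type*) [Field K] [CharZero K]

lemma constantCoeff_arsinhSqDiv : constantCoeff (arsinhSqDiv K) = 1 := by
  rw [← coeff_zero_eq_constantCoeff_apply, arsinhSqDiv, coeff_mk]
  simp

lemma arsinhOp_arsinhSq : arsinhOp (arsinhSq K) = 2 := by
  ext n
  rw [coeff_arsinhOp, ← map_ofNat (C (R := K)) 2, coeff_C, arsinhSq, coeff_succ_X_mul, arsinhSqDiv,
    coeff_mk]
  cases n with
  | zero => simp
  | succ n =>
    have hfac : ((2 * (n + 1)).factorial : K) ≠ 0 := Nat.cast_ne_zero.2 (Nat.factorial_ne_zero _)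
    have n_add_two_ne : (n + 1 + 1 : K) ≠ 0 := by norm_cast
    have two_n_add_three_ne : (2 * (n + 1) + 1 : K) ≠ 0 := by norm_cast
    rw [coeff_succ_X_mul, coeff_mk, if_neg n.succ_ne_zero, cast_factorial_two_mul_succ K (n + 1),
      Nat.factorial_succ]
    push_cast
    field_simp
    ring

/-- In the coordinate `h` of `arsinhOp`, this says `(d(h²)/dh)² = 4h²`. -/
lemma derivative_arsinhSq_sq :
    (4 * X + X ^ 2) * d⁄dX K (arsinhSq K) ^ 2 = 4 * arsinhSq K := by
  have ode := arsinhOp_arsinhSq K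
  rw [arsinhOp] at ode
  refine derivative.ext ?_ (by simp [arsinhSq])
  have d_four : d⁄dX K (4 : K⟦X⟧) = 0 := Derivation.map_natCast _ 4
  simp only [Derivation.leibniz, derivative_pow, map_add, d_four, derivative_X, smul_eq_mul]
  push_cast
  linear_combination (2 * d⁄dX K (arsinhSq K)) * ode

lemma arsinhOp_arsinhSq_pow (k : ℕ) :
    arsinhOp (arsinhSq K ^ (k + 1)) = C ((2 * k + 2) * (2 * k + 1) : K) * arsinhSq K ^ k := by
  cases k with
  | zero => simp [arsinhOp_arsinhSq, map_ofNat]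
  | succ k =>
    rw [arsinhOp_pow_add_two, arsinhOp_arsinhSq, derivative_arsinhSq_sq]
    push_cast
    simp only [map_add, map_mul, map_natCast, map_one, map_ofNat]
    ring

lemma coeff_arsinhSq_pow (k n : ℕ) :
    coeff n (arsinhSq K ^ k) =
      ((2 * k).factorial : K) * ((evenCentralFactorial K n).coeff k / ((2 * n).factorial : K)) := by
  induction n generalizing k with
  | zero => cases k <;> simp [arsinhSq, evenCentralFactorial_zero, Polynomial.coeff_one]
  | succ n ih =>
    cases k with
    | zero => simp [coeff_zero_evenCentralFactorial_succ, coeff_one]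
    | succ k =>
      have recurrence := congrArg (coeff n) (arsinhOp_arsinhSq_pow K k)
      rw [coeff_arsinhOp, coeff_C_mul, ih, ih] at recurrence
      have hfac : ((2 * n).factorial : K) ≠ 0 := Nat.cast_ne_zero.2 (Nat.factorial_ne_zero _)
      have two_n_add_two_ne : (2 * n + 2 : K) ≠ 0 := by norm_cast
      have two_n_add_one_ne : (2 * n + 1 : K) ≠ 0 := by norm_cast
      refine mul_left_cancel₀ (mul_ne_zero two_n_add_two_ne two_n_add_one_ne) ?_
      rw [eq_sub_of_add_eq recurrence, coeff_succ_evenCentralFactorial_succ,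
        cast_factorial_two_mul_succ K k, cast_factorial_two_mul_succ K n]
      field_simp

theorem coeff_arsinhSqDiv_pow (k n : ℕ) :
    coeff n (arsinhSqDiv K ^ k) = ((2 * k).factorial : K) *
      ((evenCentralFactorial K (k + n)).coeff k / ((2 * k + 2 * n).factorial : K)) := by
  rw [← mul_add, ← coeff_arsinhSq_pow, arsinhSq, mul_pow, add_comm k n, coeff_X_pow_mul]

end Arsinh

theorem corollary5p1 (k n : ℕ) (hk : 1 ≤ k) (hn : 1 ≤ n) :
    ∑ j ∈ Finset.Icc 1 n,
        (-1 : ℚ) ^ j * ((descPochhammer ℚ j).eval (k : ℚ) / (j.factorial : ℚ)) *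
          ∑ l ∈ Finset.Icc 1 j,
            (-1 : ℚ) ^ l * ((2 * l).factorial : ℚ) * (j.choose l : ℚ) *
              (Q (2 * l) (2 * n) / ((2 * l + 2 * n).factorial : ℚ)) =
      ((2 * k).factorial : ℚ) * (Q (2 * k) (2 * n) / ((2 * k + 2 * n).factorial : ℚ)) := by
  have Q_eq_coeff {l : ℕ} (hl : 1 ≤ l) :
      ((2 * l).factorial : ℚ) * (Q (2 * l) (2 * n) / ((2 * l + 2 * n).factorial : ℚ)) =
        PowerSeries.coeff n (arsinhSqDiv ℚ ^ l) := by
    rw [coeff_arsinhSqDiv_pow, Q_two_mul_eq_coeff_evenCentralFactorial hl]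
  rw [Q_eq_coeff hk, coeff_pow_eq_sum_Icc (constantCoeff_arsinhSqDiv ℚ) (by lia)]
  refine Finset.sum_congr rfl fun j _ => ?_
  rw [← Nat.cast_choose_eq_descPochhammer_div]
  congr 1
  refine Finset.sum_congr rfl fun l hl => ?_
  rw [← Q_eq_coeff (Finset.mem_Icc.1 hl).1]
  ring
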